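/- Let $G=(S,T,E)$ be a finite bipartite graph with vertex set $V=S\sqcup T$, and let every edge $e\in E$ have a weight $w(e)>0$. For a matching $M$ of $G$ put $w(M)=\prod_{e\in M}w(e)$, let $V(M)$ be the set of vertices covered by $M$, and let $B(M)=V(M)\,\Delta\,S$, where $\Delta$ denotes symmetric difference. For $\mathcal A,\mathcal B\subseteq 2^V$ let $$\mathcal A\,\square\,\mathcal B=\{A\cup B : A\in\mathcal A,\ B\in\mathcal B,\ A\cap B=\emptyset\}.$$ Let $M$ be a random matching of $G$ (the empty matching being allowed), where the probability of each matching is proportional to its weight. Then $B(M)$ satisfies the BK inequality for increasing events, that is, for all upward closed $\mathcal A,\mathcal B\subseteq 2^V$, $$\mathbb P\big(B(M)\in\mathcal A\,\square\,\mathcal B\big)\le \mathbb P\big(B(M)\in\mathcal A\big)\,\mathbb P\big(B(M)\in\mathcal B\big).$$ -/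

import Mathlib

namespace BKMatching

open scoped symmDiff

/-- The matchings of `G`: subgraphs in which every vertex has exactly one neighbour, so that the
vertex set of such a subgraph is the set of vertices covered by its edges. -/
abbrev Matching {V : Type*} (G : SimpleGraph V) : Type _ :=
  {M : G.Subgraph // M.IsMatching}

/-- The empty matching. -/
def emptyMatching {V : Type*} (G : SimpleGraph V) : Matching G :=
  ⟨⊥, fun _ hv => hv.elim⟩

/-- The weight of a matching: the product of the weights of its edges. -/
noncomputable def weight {V : Type*} [Finite V] {G : SimpleGraph V} (w : Sym2 V → ℝ)
    (M : Matching G) : ℝ :=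
  ∏ e ∈ (Set.toFinite M.1.edgeSet).toFinset, w e

theorem weight_emptyMatching {V : Type*} [Finite V] (G : SimpleGraph V) (w : Sym2 V → ℝ) :
    weight w (emptyMatching G) = 1 := by
  simp [weight, emptyMatching]

theorem tsum_weight_ne_zero {V : Type*} [Finite V] (G : SimpleGraph V) (w : Sym2 V → ℝ) :
    ∑' M : Matching G, ENNReal.ofReal (weight w M) ≠ 0 := by
  intro h
  have h0 := ENNReal.tsum_eq_zero.mp h (emptyMatching G)
  simp [weight_emptyMatching] at h0

theorem tsum_weight_ne_top {V : Type*} [Finite V] (G : SimpleGraph V) (w : Sym2 V → ℝ) :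
    ∑' M : Matching G, ENNReal.ofReal (weight w M) ≠ ⊤ := by
  have := Fintype.ofFinite (Matching G)
  rw [tsum_fintype]
  exact ENNReal.sum_ne_top.mpr fun _ _ => ENNReal.ofReal_ne_top

/-- The law of the random matching whose probabilities are proportional to the weights. -/
noncomputable def randomMatching {V : Type*} [Finite V] (G : SimpleGraph V) (w : Sym2 V → ℝ) :
    PMF (Matching G) :=
  PMF.normalize (fun M => ENNReal.ofReal (weight w M))
    (tsum_weight_ne_zero G w) (tsum_weight_ne_top G w)

/-- `B(M) = V(M) ∆ S`. -/
def coverSymmDiff {V : Type*} {G : SimpleGraph V} (S : Set V) (M : Matching G) : Set V :=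
  M.1.verts ∆ S

/-- The law of the random set `B(M)`, for the weighted random matching `M`. -/
noncomputable def randomSet {V : Type*} [Finite V] (G : SimpleGraph V) (S : Set V)
    (w : Sym2 V → ℝ) : PMF (Set V) :=
  (randomMatching G w).map (coverSymmDiff S)

/-- The probability that a random subset of `V` with law `μ` belongs to `𝒜`. -/
noncomputable def prob {V : Type*} (μ : PMF (Set V)) (𝒜 : Set (Set V)) : ENNReal :=
  @PMF.toMeasure (Set V) ⊤ μ 𝒜

/-- The disjoint occurrence `𝒜 □ ℬ` of two events. -/
def disjointOccurrence {V : Type*} (𝒜 ℬ : Set (Set V)) : Set (Set V) :=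
  {C | ∃ A ∈ 𝒜, ∃ B ∈ ℬ, A ∩ B = ∅ ∧ C = A ∪ B}

end BKMatching

namespace BKMatching

/-! ### Antipodal counting on the Boolean cube -/

open Matrix

/-! Take two independent copies `M`, `N` of the matching. Exchanging them on components of their
overlay preserves the product weight, so averaging over all exchange patterns `x` reduces the
inequality to a count over `x` for a fixed pair (`card_swap_disjointOccurrence_le`). By
bipartiteness, each component contains at most one vertex of `B(M) \ B(N)` and at most one of `B(N)
\ B(M)` (`eq_of_mem_coverSymmDiff_sdiff`). Disjoint witnesses therefore depend on disjoint sets of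
bits of `x`, up to vertices common to `B(M)` and `B(N)`, and the Reimer-type bound
`card_le_card_antipodal` applies: the antipode of `x` interchanges the two resulting matchings. -/

theorem det_ne_zero_of_map_eq_one {n : Type*} [Fintype n] [DecidableEq n] (p : ℕ) [Fact p.Prime]
    (M : Matrix n n ℤ) (h : M.map (Int.cast : ℤ → ZMod p) = 1) :
    (M.map (Int.cast : ℤ → ℚ)).det ≠ 0 := by
  have h1 : ((M.det : ℤ) : ZMod p) = 1 := by
    rw [Int.cast_det, h, det_one]
  rw [← Int.cast_det]
  intro h0
  rw [Int.cast_eq_zero.mp h0] at h1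
  simp at h1

/-- If every `x ∈ F` has a set of coordinates `I x` such that `A` contains all points agreeing
with `x` on `I x`, and `B` all points agreeing with `x` off `I x`, then `F` is at most as large as
the set of points of `A` whose antipode is in `B`. -/
theorem card_le_card_antipodal {ι : Type*} [Fintype ι] [DecidableEq ι]
    (F A B : Finset (ι → Bool)) (I : (ι → Bool) → Set ι)
    (hA : ∀ x ∈ F, ∀ y : ι → Bool, (∀ i ∈ I x, y i = x i) → y ∈ A)
    (hB : ∀ x ∈ F, ∀ y : ι → Bool, (∀ i ∉ I x, y i = x i) → y ∈ B) :
    F.card ≤ (A.filter fun y => (fun i => !y i) ∈ B).card := by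
  classical
  -- The entries make `W` the identity mod 2 and `P` the identity mod 3, while `(-3) * 4 + 4 * 3 =
  -- 0` kills the factor of `W * P` at any `i ∉ I x` with `z i = x i`.
  let W : Matrix (ι → Bool) (ι → Bool) ℤ := fun x y =>
    ∏ i, if i ∈ I x then (if y i = x i then 1 else 0) else (if y i = x i then -3 else 4)
  let P : Matrix (ι → Bool) (ι → Bool) ℤ := fun y z =>
    ∏ i, if y i = z i then 4 else 3
  have hW (x y) : W x y = ∏ i, if i ∈ I x then (if y i = x i then 1 else 0)
      else (if y i = x i then -3 else 4) := rfl
  have hP (y z) : P y z = ∏ i, if y i = z i then 4 else 3 := rfl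
  have hWdet : (W.map (Int.cast : ℤ → ℚ)).det ≠ 0 := by
    apply det_ne_zero_of_map_eq_one 2
    ext x y
    rw [map_apply, hW, Int.cast_prod]
    by_cases hxy : x = y
    · subst hxy
      rw [one_apply_eq]
      refine Finset.prod_eq_one fun i _ => ?_
      by_cases hi : i ∈ I x
      · simp [hi]
      · simp only [hi, if_false, if_true]
        decide
    · rw [one_apply_ne hxy]
      obtain ⟨i, hi⟩ := Function.ne_iff.mp hxy
      refine Finset.prod_eq_zero (Finset.mem_univ i) ?_
      by_cases h : i ∈ I x
      · simp [h, Ne.symm hi]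
      · simp only [h, Ne.symm hi, if_false]
        decide
  have hPdet (D : Finset (ι → Bool)) :
      ((P.submatrix (Subtype.val : D → _) Subtype.val).map (Int.cast : ℤ → ℚ)).det ≠ 0 := by
    apply det_ne_zero_of_map_eq_one 3
    ext x y
    rw [map_apply, submatrix_apply, hP, Int.cast_prod]
    by_cases hxy : x = y
    · subst hxy
      rw [one_apply_eq]
      refine Finset.prod_eq_one fun i _ => ?_
      rw [if_pos rfl]
      decide
    · rw [one_apply_ne hxy]
      obtain ⟨i, hi⟩ := Function.ne_iff.mp (Subtype.coe_ne_coe.mpr hxy)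
      refine Finset.prod_eq_zero (Finset.mem_univ i) ?_
      rw [if_neg hi]
      decide
  have hWP (x : ι → Bool) (hx : x ∈ F) (z : ι → Bool) (hz : (fun i => !z i) ∉ B) :
      ∑ y, W x y * P y z = 0 := by
    have hi : ∃ i ∉ I x, z i = x i := by
      by_contra! h
      exact hz (hB x hx _ fun i hi =>
        Bool.not_eq.mpr (h i hi))
    obtain ⟨i, hi, hzi⟩ := hi
    have := Finset.prod_univ_sum (fun _ : ι => (Finset.univ : Finset Bool)) (fun i b =>
      (if i ∈ I x then (if b = x i then (1 : ℤ) else 0) else (if b = x i then -3 else 4)) *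
        if b = z i then 4 else 3)
    simp only [Fintype.piFinset_univ, Finset.prod_mul_distrib] at this
    simp only [hW, hP]
    rw [← this]
    refine Finset.prod_eq_zero (Finset.mem_univ i) ?_
    rw [hzi]
    cases x i <;> simp [hi]
  set D := A.filter fun y => (fun i => !y i) ∈ B with hD
  -- Rows of `W` indexed by `F`, restricted to `D`, stay independent, so `F` has at most `D.card`
  -- elements.
  have hli : LinearIndependent ℚ (fun (x : F) (y : D) => (W x y : ℚ)) := by
    rw [Fintype.linearIndependent_iff]
    intro c hc
    set c' : (ι → Bool) → ℚ := fun x => if hx : x ∈ F then c ⟨x, hx⟩ else 0 with hc'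
    set v := c' ᵥ* W.map (Int.cast : ℤ → ℚ) with hv
    have hvsum (y) : v y = ∑ x : F, c x * (W x y : ℚ) := by
      simp only [hv, vecMul, dotProduct, map_apply]
      rw [← Finset.sum_subset (Finset.subset_univ F), ← Finset.sum_coe_sort]
      · simp [hc']
      · intro x _ hx
        simp [hc', hx]
    have hvD (y) (hy : y ∈ D) : v y = 0 := by
      have := congrFun hc ⟨y, hy⟩
      simpa [hvsum] using this
    have hvA (y) (hy : y ∉ A) : v y = 0 := by
      rw [hvsum]
      refine Finset.sum_eq_zero fun x _ => ?_
      have : ∃ i ∈ I x, y i ≠ x.1 i := by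
        by_contra! h
        exact hy (hA x x.2 y h)
      obtain ⟨i, hi, hne⟩ := this
      have : W x.1 y = 0 := Finset.prod_eq_zero (Finset.mem_univ i) (by simp [hi, hne])
      simp [this]
    have hvP (z : ι → Bool) (hz : (fun i => !z i) ∉ B) : ∑ y, v y * (P y z : ℚ) = 0 := by
      simp only [hvsum, Finset.sum_mul]
      rw [Finset.sum_comm]
      refine Finset.sum_eq_zero fun x _ => ?_
      have := hWP x x.2 z hz
      simp only [mul_assoc, ← Finset.mul_sum]
      rw_mod_cast [this]
      simp
    -- Now `v` is supported on `E`, and `v * P` vanishes there; the principal submatrix of `P` on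
    -- `E` is nonsingular.
    have hvE (y) : v y = 0 := by
      let E := A.filter fun y => (fun i => !y i) ∉ B
      have h0 : (fun y : E => v y) = 0 := by
        refine eq_zero_of_vecMul_eq_zero (hPdet E) ?_
        ext z
        rw [Pi.zero_apply, ← hvP z (Finset.mem_filter.mp z.2).2]
        simp only [vecMul, dotProduct, map_apply, submatrix_apply]
        rw [← Finset.sum_subset (Finset.subset_univ E)]
        · exact Finset.sum_coe_sort E fun y => v y * (P y z : ℚ)
        intro y _ hy
        have : v y = 0 := by
          by_cases hyA : y ∈ A
          · refine hvD y (Finset.mem_filter.mpr ⟨hyA, ?_⟩)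
            by_contra hyB
            exact hy (by simp [E, hyA, hyB])
          · exact hvA y hyA
        simp [this]
      by_cases hyA : y ∈ A
      · by_cases hyB : (fun i => !y i) ∈ B
        · exact hvD y (by simp [hD, hyA, hyB])
        · exact congrFun h0 ⟨y, Finset.mem_filter.mpr ⟨hyA, hyB⟩⟩
      · exact hvA y hyA
    have hc0 : c' = 0 := eq_zero_of_vecMul_eq_zero hWdet (funext hvE)
    intro x
    simpa [hc'] using congrFun hc0 x
  simpa using hli.fintype_card_le_finrank

open scoped symmDiff

/-! ### Exchanging two matchings on components of their overlay -/

section Swap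

variable {V : Type*} {G : SimpleGraph V}

/-- The subgraph that agrees with `M` off `U` and with `N` on `U`. -/
def mix (M N : G.Subgraph) (U : Set V) : G.Subgraph where
  verts := {v | v ∉ U ∧ v ∈ M.verts ∨ v ∈ U ∧ v ∈ N.verts}
  Adj a b := a ∉ U ∧ b ∉ U ∧ M.Adj a b ∨ a ∈ U ∧ b ∈ U ∧ N.Adj a b
  adj_sub := by
    rintro a b (⟨-, -, h⟩ | ⟨-, -, h⟩)
    exacts [h.adj_sub, h.adj_sub]
  edge_vert := by
    rintro a b (⟨h, -, h'⟩ | ⟨h, -, h'⟩)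
    exacts [Or.inl ⟨h, h'.fst_mem⟩, Or.inr ⟨h, h'.fst_mem⟩]
  symm := by
    constructor
    rintro a b (⟨h, h', h''⟩ | ⟨h, h', h''⟩)
    exacts [Or.inl ⟨h', h, h''.symm⟩, Or.inr ⟨h', h, h''.symm⟩]

/-- No edge of `M` or `N` leaves `U`. -/
def Saturated (M N : G.Subgraph) (U : Set V) : Prop :=
  ∀ ⦃a b⦄, M.Adj a b ∨ N.Adj a b → (a ∈ U ↔ b ∈ U)

theorem Saturated.symm {M N : G.Subgraph} {U : Set V} (h : Saturated M N U) :
    Saturated N M U := fun _ _ hab => h hab.symm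

theorem Saturated.mix_adj {M N : G.Subgraph} {U : Set V} (h : Saturated M N U) {a b : V} :
    (mix M N U).Adj a b ↔ a ∉ U ∧ M.Adj a b ∨ a ∈ U ∧ N.Adj a b := by
  constructor
  · rintro (⟨h, -, h'⟩ | ⟨h, -, h'⟩)
    exacts [Or.inl ⟨h, h'⟩, Or.inr ⟨h, h'⟩]
  · rintro (⟨h₁, h₂⟩ | ⟨h₁, h₂⟩)
    · exact Or.inl ⟨h₁, (h (Or.inl h₂)).not.mp h₁, h₂⟩
    · exact Or.inr ⟨h₁, (h (Or.inr h₂)).mp h₁, h₂⟩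

theorem Saturated.isMatching_mix {M N : G.Subgraph} {U : Set V} (h : Saturated M N U)
    (hM : M.IsMatching) (hN : N.IsMatching) : (mix M N U).IsMatching := by
  intro v hv
  simp only [h.mix_adj]
  by_cases hU : v ∈ U
  · simpa [hU] using hN (by simpa [mix, hU] using hv)
  · simpa [hU] using hM (by simpa [mix, hU] using hv)

theorem Saturated.mix_mix {M N : G.Subgraph} {U : Set V} (h : Saturated M N U) :
    mix (mix M N U) (mix N M U) U = M := by
  ext a b
  · by_cases ha : a ∈ U <;> simp [mix, ha]
  · have := @h a b
    simp only [mix]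
    tauto

theorem mix_compl (M N : G.Subgraph) (U : Set V) : mix M N Uᶜ = mix N M U := by
  ext a b
  · simp only [mix, Set.mem_compl_iff, Set.mem_ofPred_eq]
    tauto
  · simp only [mix, Set.mem_compl_iff]
    tauto

theorem Saturated.edgeSet_union {M N : G.Subgraph} {U : Set V} (h : Saturated M N U) :
    (mix M N U).edgeSet ∪ (mix N M U).edgeSet = M.edgeSet ∪ N.edgeSet := by
  ext e
  induction e with | _ a b =>
  simp only [Set.mem_union, SimpleGraph.Subgraph.mem_edgeSet, h.mix_adj, h.symm.mix_adj]
  tauto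

theorem Saturated.edgeSet_inter {M N : G.Subgraph} {U : Set V} (h : Saturated M N U) :
    (mix M N U).edgeSet ∩ (mix N M U).edgeSet = M.edgeSet ∩ N.edgeSet := by
  ext e
  induction e with | _ a b =>
  simp only [Set.mem_inter_iff, SimpleGraph.Subgraph.mem_edgeSet, h.mix_adj, h.symm.mix_adj]
  tauto

/-- The graph on `V` whose edges are those of `M` and `N`. -/
def overlay (M N : G.Subgraph) : SimpleGraph V := M.spanningCoe ⊔ N.spanningCoe

theorem overlay_adj {M N : G.Subgraph} {a b : V} :
    (overlay M N).Adj a b ↔ M.Adj a b ∨ N.Adj a b := Iff.rfl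

theorem overlay_comm (M N : G.Subgraph) : overlay M N = overlay N M := sup_comm _ _

theorem Saturated.overlay_mix {M N : G.Subgraph} {U : Set V} (h : Saturated M N U) :
    overlay (mix M N U) (mix N M U) = overlay M N := by
  ext a b
  simp only [overlay_adj, h.mix_adj, h.symm.mix_adj]
  tauto

/-- A vertex chosen in the connected component of `v`. -/
noncomputable def componentRep (H : SimpleGraph V) (v : V) : V := (H.connectedComponentMk v).out

theorem componentRep_eq_iff {H : SimpleGraph V} {a b : V} :
    componentRep H a = componentRep H b ↔ H.Reachable a b := by
  rw [← SimpleGraph.ConnectedComponent.eq]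
  exact (Function.LeftInverse.injective (g := Quot.mk _) Quot.out_eq).eq_iff

/-- The union of the connected components of `H` whose chosen vertex is selected by `x`. -/
def selected (H : SimpleGraph V) (x : V → Bool) : Set V := {v | x (componentRep H v) = true}

theorem selected_not (H : SimpleGraph V) (x : V → Bool) :
    selected H (fun v => !x v) = (selected H x)ᶜ := by
  ext v
  simp [selected]

theorem saturated_selected (M N : G.Subgraph) (x : V → Bool) :
    Saturated M N (selected (overlay M N) x) := by
  intro a b hab
  have : componentRep (overlay M N) a = componentRep (overlay M N) b :=
    componentRep_eq_iff.mpr (overlay_adj.mpr hab).reachable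
  simp [selected, this]

/-- Exchange the two matchings on the components of their union selected by `x`. -/
def swap (x : V → Bool) (p : Matching G × Matching G) : Matching G × Matching G :=
  (⟨mix p.1.1 p.2.1 (selected (overlay p.1.1 p.2.1) x),
    (saturated_selected _ _ x).isMatching_mix p.1.2 p.2.2⟩,
   ⟨mix p.2.1 p.1.1 (selected (overlay p.1.1 p.2.1) x),
    (saturated_selected _ _ x).symm.isMatching_mix p.2.2 p.1.2⟩)

/-- The exchange leaves the overlay unchanged, so the second application selects the same
components. -/
theorem swap_involutive (x : V → Bool) : Function.Involutive (swap (G := G) x) := by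
  rintro ⟨M, N⟩
  have h := saturated_selected M.1 N.1 x
  refine Prod.ext (Subtype.ext ?_) (Subtype.ext ?_)
  · simp only [swap, h.overlay_mix, h.mix_mix]
  · simp only [swap, h.overlay_mix, h.symm.mix_mix]

theorem swap_not_fst (x : V → Bool) (p : Matching G × Matching G) :
    (swap (fun v => !x v) p).1 = (swap x p).2 := by
  apply Subtype.ext
  simp only [swap, selected_not, mix_compl]

/-- The union and the intersection of the two edge sets are both preserved. -/
theorem weight_swap [Finite V] (w : Sym2 V → ℝ) (x : V → Bool) (p : Matching G × Matching G) :
    weight w (swap x p).1 * weight w (swap x p).2 = weight w p.1 * weight w p.2 := by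
  classical
  have h := saturated_selected p.1.1 p.2.1 x
  simp only [weight]
  rw [← Finset.prod_union_inter, ← Finset.prod_union_inter (s₁ := Set.Finite.toFinset _)]
  congr 1
  · refine Finset.prod_congr ?_ fun _ _ => rfl
    rw [← Finset.coe_inj]
    simpa [swap] using h.edgeSet_union
  · refine Finset.prod_congr ?_ fun _ _ => rfl
    rw [← Finset.coe_inj]
    simpa [swap] using h.edgeSet_inter

theorem mem_coverSymmDiff_swap {S : Set V} {x : V → Bool} {p : Matching G × Matching G} {v : V} :
    v ∈ coverSymmDiff S (swap x p).1 ↔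
      if x (componentRep (overlay p.1.1 p.2.1) v) = true then v ∈ coverSymmDiff S p.2
        else v ∈ coverSymmDiff S p.1 := by
  by_cases h : x (componentRep (overlay p.1.1 p.2.1) v) = true <;>
    simp [coverSymmDiff, swap, mix, selected, h, Set.mem_symmDiff]

/-- In each component of the union of two matchings of a bipartite graph, at most one vertex
belongs to `B(M)` but not to `B(N)`. -/
theorem eq_of_mem_coverSymmDiff_sdiff {S T : Set V} (hG : G.IsBipartiteWith S T)
    {M N : Matching G} {u v : V} (huv : (overlay M.1 N.1).Reachable u v)
    (hu : u ∈ coverSymmDiff S M \ coverSymmDiff S N)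
    (hv : v ∈ coverSymmDiff S M \ coverSymmDiff S N) : u = v := by
  -- Orient `N`-edges out of `S` and `M`-edges into `S`. In-degrees are at most one and vertices of
  -- `B(M) \ B(N)` are sources, so everything in the component of `u` is reached from `u` along `r`.
  let r : V → V → Prop := fun a b => a ∈ S ∧ N.1.Adj a b ∨ a ∉ S ∧ M.1.Adj a b
  have hS {a b : V} (h : G.Adj a b) : a ∈ S ↔ b ∉ S := by
    have hd := Set.disjoint_left.mp hG.disjoint
    rcases hG.mem_of_adj h with ⟨h₁, h₂⟩ | ⟨h₁, h₂⟩
    · exact ⟨fun _ h => hd h h₂, fun _ => h₁⟩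
    · exact ⟨fun h => (hd h h₁).elim, fun h => (h h₂).elim⟩
  have hsource {a b : V} (hb : b ∈ coverSymmDiff S M \ coverSymmDiff S N) : ¬ r a b := by
    simp only [coverSymmDiff, Set.mem_sdiff, Set.mem_symmDiff] at hb
    rintro (⟨ha, h⟩ | ⟨ha, h⟩)
    · have := (hS h.adj_sub).mp ha
      have := h.snd_mem
      tauto
    · have := (hS h.adj_sub).not_left.mp ha
      have := h.snd_mem
      tauto
  have hinj {a b c : V} (hac : r a c) (hbc : r b c) : a = b := by
    rcases hac with ⟨ha, hac⟩ | ⟨ha, hac⟩ <;> rcases hbc with ⟨hb, hbc⟩ | ⟨hb, hbc⟩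
    · exact N.2.eq_of_adj_right hac hbc
    · exact (hb ((hS hbc.adj_sub).mpr ((hS hac.adj_sub).mp ha))).elim
    · exact (ha ((hS hac.adj_sub).mpr ((hS hbc.adj_sub).mp hb))).elim
    · exact M.2.eq_of_adj_right hac hbc
  have hr {a b : V} (h : (overlay M.1 N.1).Adj a b) : r a b ∨ r b a := by
    have hab : M.1.Adj a b ∨ N.1.Adj a b := h
    have h₁ : a ∈ S ↔ b ∉ S := hS (hab.elim (·.adj_sub) (·.adj_sub))
    have h₂ : M.1.Adj a b ↔ M.1.Adj b a := M.1.adj_comm a b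
    have h₃ : N.1.Adj a b ↔ N.1.Adj b a := N.1.adj_comm a b
    simp only [r]
    tauto
  have hpath : Relation.ReflTransGen r u v := by
    rw [SimpleGraph.reachable_iff_reflTransGen] at huv
    clear hv
    induction huv with
    | refl => exact .refl
    | @tail b c _ hbc ih =>
      rcases hr hbc with h | h
      · exact ih.tail h
      · rcases ih.cases_tail with rfl | ⟨d, hd, hdb⟩
        · exact (hsource hu h).elim
        · exact hinj hdb h ▸ hd
  rcases hpath.cases_tail with h | ⟨d, -, hd⟩
  · exact h.symm
  · exact (hsource hv hd).elim

end Swap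

/-! ### The count for a fixed pair of matchings -/

/-- The counting form of the inequality on one class of pairs of matchings. -/
theorem card_swap_disjointOccurrence_le {V : Type*} [Fintype V] [DecidableEq V] {G : SimpleGraph V}
    {S T : Set V} (hG : G.IsBipartiteWith S T) {𝒜 ℬ : Set (Set V)} (h𝒜 : IsUpperSet 𝒜)
    (hℬ : IsUpperSet ℬ) (p : Matching G × Matching G) [DecidablePred (· ∈ 𝒜)]
    [DecidablePred (· ∈ ℬ)] [DecidablePred (· ∈ disjointOccurrence 𝒜 ℬ)] :
    (Finset.univ.filter fun x : V → Bool =>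
      coverSymmDiff S (swap x p).1 ∈ disjointOccurrence 𝒜 ℬ).card ≤
    (Finset.univ.filter fun x : V → Bool =>
      coverSymmDiff S (swap x p).1 ∈ 𝒜 ∧ coverSymmDiff S (swap x p).2 ∈ ℬ).card := by
  classical
  set rep := componentRep (overlay p.1.1 p.2.1) with hrep
  set K := coverSymmDiff S p.1 ∩ coverSymmDiff S p.2 with hK
  let b : (V → Bool) → Set V := fun x => coverSymmDiff S (swap x p).1
  have hb {x v} : v ∈ b x ↔ if x (rep v) = true then v ∈ coverSymmDiff S p.2
      else v ∈ coverSymmDiff S p.1 := mem_coverSymmDiff_swap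
  have hbK {x v} (hv : v ∈ K) : v ∈ b x := by
    rw [hb]; split_ifs
    exacts [hv.2, hv.1]
  have hbcongr {x y v} (hv : v ∈ b x) (h : y (rep v) = x (rep v)) : v ∈ b y := by
    rw [hb] at hv ⊢; rwa [h]
  have huniq {x u v} (hu : u ∈ b x) (hv : v ∈ b x) (huK : u ∉ K) (hvK : v ∉ K)
      (huv : rep u = rep v) : u = v := by
    have hreach := componentRep_eq_iff.mp huv
    rw [hb] at hu hv
    rw [huv] at hu
    split_ifs at hu hv
    · rw [overlay_comm] at hreach
      exact eq_of_mem_coverSymmDiff_sdiff hG hreach ⟨hu, fun h => huK ⟨h, hu⟩⟩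
        ⟨hv, fun h => hvK ⟨h, hv⟩⟩
    · exact eq_of_mem_coverSymmDiff_sdiff hG hreach ⟨hu, fun h => huK ⟨hu, h⟩⟩
        ⟨hv, fun h => hvK ⟨hv, h⟩⟩
  have hex (x : V → Bool) : ∃ I : Set V, b x ∈ disjointOccurrence 𝒜 ℬ →
      (∀ y : V → Bool, (∀ i ∈ I, y i = x i) → b y ∈ 𝒜) ∧
      (∀ y : V → Bool, (∀ i ∉ I, y i = x i) → b y ∈ ℬ) := by
    by_cases hx : b x ∈ disjointOccurrence 𝒜 ℬ
    · obtain ⟨A, hA, B, hB, hAB, hC⟩ := hx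
      have hAx : A ⊆ b x := hC ▸ Set.subset_union_left
      have hBx : B ⊆ b x := hC ▸ Set.subset_union_right
      -- Vertices of `K` are present for every `x`, so only `A \ K` needs bits; by `huniq`, no
      -- vertex of `B \ K` shares a component with it.
      refine ⟨rep '' (A \ K), fun _ => ⟨fun y hy => h𝒜 (fun v hv => ?_) hA,
        fun y hy => hℬ (fun v hv => ?_) hB⟩⟩
      · by_cases hvK : v ∈ K
        · exact hbK hvK
        · exact hbcongr (hAx hv) (hy _ ⟨v, ⟨hv, hvK⟩, rfl⟩)
      · by_cases hvK : v ∈ K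
        · exact hbK hvK
        · refine hbcongr (hBx hv) (hy _ ?_)
          rintro ⟨u, ⟨hu, huK⟩, huv⟩
          obtain rfl := huniq (hAx hu) (hBx hv) huK hvK huv
          exact Set.eq_empty_iff_forall_notMem.mp hAB u ⟨hu, hv⟩
    · exact ⟨∅, fun h => (hx h).elim⟩
  choose I hI using hex
  have := card_le_card_antipodal (Finset.univ.filter fun x => b x ∈ disjointOccurrence 𝒜 ℬ)
    (Finset.univ.filter fun x => b x ∈ 𝒜) (Finset.univ.filter fun x => b x ∈ ℬ) I
    (fun x hx y hy => by simpa using (hI x (by simpa using hx)).1 y hy)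
    (fun x hx y hy => by simpa using (hI x (by simpa using hx)).2 y hy)
  rw [Finset.filter_filter] at this
  simpa [b, swap_not_fst] using this

/-! ### From counting to probabilities -/

theorem prob_randomSet {V : Type*} [Finite V] (G : SimpleGraph V) (S : Set V) (w : Sym2 V → ℝ)
    [Fintype (Matching G)] (𝒜 : Set (Set V)) [DecidablePred (· ∈ 𝒜)] :
    prob (randomSet G S w) 𝒜 =
      ∑ M, if coverSymmDiff S M ∈ 𝒜 then randomMatching G w M else 0 := by
  rw [prob, randomSet, @PMF.toMeasure_apply_eq_toOuterMeasure_apply _ ⊤ _ _ trivial,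
    PMF.toOuterMeasure_map_apply, PMF.toOuterMeasure_apply_fintype]
  refine Finset.sum_congr rfl fun M _ => ?_
  by_cases h : coverSymmDiff S M ∈ 𝒜
  · rw [if_pos h, Set.indicator_of_mem (Set.mem_preimage.mpr h)]
  · rw [if_neg h, Set.indicator_of_notMem (Set.mem_preimage.not.mpr h)]

theorem weight_nonneg {V : Type*} [Finite V] {G : SimpleGraph V} {w : Sym2 V → ℝ}
    (hw : ∀ e ∈ G.edgeSet, 0 < w e) (M : Matching G) : 0 ≤ weight w M :=
  Finset.prod_nonneg fun e he =>
    (hw e (M.1.edgeSet_subset ((Set.toFinite M.1.edgeSet).mem_toFinset.mp he))).le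

theorem randomMatching_swap {V : Type*} [Finite V] {G : SimpleGraph V} {w : Sym2 V → ℝ}
    (hw : ∀ e ∈ G.edgeSet, 0 < w e) (x : V → Bool) (p : Matching G × Matching G) :
    randomMatching G w (swap x p).1 * randomMatching G w (swap x p).2 =
      randomMatching G w p.1 * randomMatching G w p.2 := by
  simp only [randomMatching, PMF.normalize_apply]
  rw [mul_mul_mul_comm, mul_mul_mul_comm (ENNReal.ofReal (weight w p.1)),
    ← ENNReal.ofReal_mul (weight_nonneg hw _), ← ENNReal.ofReal_mul (weight_nonneg hw _),
    weight_swap]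

end BKMatching

theorem theorem2 {V : Type*} [Finite V] (G : SimpleGraph V) (S T : Set V)
    (hST : S ∪ T = Set.univ) (hG : G.IsBipartiteWith S T)
    (w : Sym2 V → ℝ) (hw : ∀ e ∈ G.edgeSet, 0 < w e)
    (𝒜 ℬ : Set (Set V)) (h𝒜 : IsUpperSet 𝒜) (hℬ : IsUpperSet ℬ) :
    BKMatching.prob (BKMatching.randomSet G S w) (BKMatching.disjointOccurrence 𝒜 ℬ) ≤
      BKMatching.prob (BKMatching.randomSet G S w) 𝒜 *
        BKMatching.prob (BKMatching.randomSet G S w) ℬ := by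
  classical
  have := Fintype.ofFinite V
  have := Fintype.ofFinite (BKMatching.Matching G)
  simp only [BKMatching.prob_randomSet]
  set q := BKMatching.randomMatching G w with hq
  set b := BKMatching.coverSymmDiff (G := G) S
  set Q : BKMatching.Matching G × BKMatching.Matching G → ENNReal := fun p => q p.1 * q p.2
  have hsum : ∑ M, q M = 1 := by simpa only [tsum_fintype] using q.tsum_coe
  have hleft : (∑ M, if b M ∈ BKMatching.disjointOccurrence 𝒜 ℬ then q M else 0) =
      ∑ p, if b p.1 ∈ BKMatching.disjointOccurrence 𝒜 ℬ then Q p else 0 := by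
    rw [← mul_one (∑ M, _), ← hsum, Finset.sum_mul_sum, Fintype.sum_prod_type]
    simp [Q, ite_mul]
  have hright : ((∑ M, if b M ∈ 𝒜 then q M else 0) * ∑ M, if b M ∈ ℬ then q M else 0) =
      ∑ p, if b p.1 ∈ 𝒜 ∧ b p.2 ∈ ℬ then Q p else 0 := by
    rw [Finset.sum_mul_sum, Fintype.sum_prod_type]
    refine Finset.sum_congr rfl fun M _ => Finset.sum_congr rfl fun N _ => ?_
    by_cases hM : b M ∈ 𝒜 <;> by_cases hN : b N ∈ ℬ <;> simp [Q, hM, hN]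
  -- Each `swap x` is a `Q`-preserving bijection, so the sum may be averaged over all `x`.
  have haverage (E : BKMatching.Matching G × BKMatching.Matching G → Prop) [DecidablePred E] :
      (Fintype.card (V → Bool) : ENNReal) * ∑ p, (if E p then Q p else 0) =
        ∑ p, ((Finset.univ.filter fun x : V → Bool => E (BKMatching.swap x p)).card : ENNReal) *
          Q p := by
    have h (x : V → Bool) : ∑ p, (if E p then Q p else 0) =
        ∑ p, if E (BKMatching.swap x p) then Q p else 0 := by
      rw [← Equiv.sum_comp (BKMatching.swap_involutive x).toPerm]
      refine Finset.sum_congr rfl fun p _ => ?_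
      have : Q (BKMatching.swap x p) = Q p := BKMatching.randomMatching_swap hw x p
      simp [this]
    rw [← nsmul_eq_mul, ← Finset.card_univ, ← Finset.sum_const, Finset.sum_congr rfl fun x _ => h x,
      Finset.sum_comm]
    refine Finset.sum_congr rfl fun p _ => ?_
    rw [← Finset.sum_filter, Finset.sum_const, nsmul_eq_mul]
  rw [hleft, hright, ← ENNReal.mul_le_mul_iff_right
    (a := (Fintype.card (V → Bool) : ENNReal)) (by simp) (by simp), haverage, haverage]
  refine Finset.sum_le_sum fun p _ => mul_le_mul_left (Nat.cast_le.mpr ?_) _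
  exact BKMatching.card_swap_disjointOccurrence_le hG h𝒜 hℬ p
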